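/- Let $\mathcal G=(V,\mathcal E)$ be a digraph without self loops on $V=\{1,\dots,n\}$, let $\mathcal N_i=\{j\in V : (j,i)\in\mathcal E\}$, and consider the interconnected system $$\dot x_i=f_i(x_i,x_{\mathcal N_i}),\qquad i\in V,\quad x_i\in\mathbb R,$$ where every $f_i:\mathbb R^{|\mathcal N_i|+1}\to\mathbb R$ is continuously differentiable, evolving on the positive orthant $\mathbb R^n_{\ge 0}$. Write $f=(f_1,\dots,f_n)$ for the resulting vector field on $\mathbb R^n$ and $J(x)$ for its Jacobian matrix. For a real square matrix $A=(a_{ij})$ with negative diagonal entries, let $\mathcal G(A)$ be the digraph with an edge from $j$ to $i$ whenever $a_{ij}\ne 0$, and let $\Phi_A$ be its set of simple cycles (closed directed paths without repeated nodes other than the endpoint, self loops excluded, taken up to the choice of the starting node). The gain of a simple cycle $c=(i_1,i_2,\dots,i_k,i_1)$ is $$\gamma_c=\frac{a_{i_2i_1}}{-a_{i_2i_2}}\cdot\frac{a_{i_3i_2}}{-a_{i_3i_3}}\cdots\frac{a_{i_1i_k}}{-a_{i_1i_1}},$$ and the total cycle gain of $A$ is $$\gamma_A=\sum_{\ell=1}^{|\Phi_A|}\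 \sum_{\{c_1,\dots,c_\ell\}\in K_\ell}(-1)^{\ell-1}\gamma_{c_1}\cdots\gamma_{c_\ell},$$ where $K_\ell$ is the family of all sets of $\ell$ simple cycles of $\mathcal G(A)$ that are pairwise node-disjoint ($\gamma_A=0$ if $\Phi_A=\emptyset$). **Theorem (Sum-interconnection stability).** \label{thm:GAS-sum-interconnected} Assume that $f(0)=0$ and that for every $x\in\mathbb R^n_{\ge 0}$ the matrix $J(x)$ is Metzler (its off-diagonal entries are nonnegative) with negative diagonal entries. Assume moreover that there are positive numbers $\gamma_{ij}$, for $i\in V$ and $j\in\mathcal N_i$, such that 1. for every $i\in V$ and $j\in\mathcal N_i$, $$\frac{J_{ij}(x)}{-J_{ii}(x)}\le\gamma_{ij}\qquad\text{for all }x\in\mathbb R^n_{\ge 0};$$ 2. for every $i\in\{1,\dots,n\}$, $\gamma_{M_I}<1$, where $M_I$ is the leading principal submatrix with index set $I=\{1,\dots,i\}$ of the matrix $M\in\mathbb R^{n\times n}$ with entries $m_{ij}=\gamma_{ij}$ if $(j,i)\in\mathcal E$, $m_{ii}=-1$, and $m_{ij}=0$ otherwise. Then $0$ is globally asymptotically stable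 for the system on $\mathbb R^n_{\ge 0}$: every initial state in $\mathbb R^n_{\ge 0}$ has a solution defined for all $t\ge 0$, solutions that start in $\mathbb R^n_{\ge 0}$ remain there, $0$ is a Lyapunov stable equilibrium, and every solution that starts in $\mathbb R^n_{\ge 0}$ converges to $0$ as $t\to\infty$. -/

import Mathlib

open Set Filter Topology

noncomputable section

/-- A matrix is Metzler if its off-diagonal entries are nonnegative. -/
def IsMetzler {V : Type*} (A : Matrix V V ℝ) : Prop :=
  ∀ i j, i ≠ j → 0 ≤ A i j

/-! ### Simple cycles and cycle gains

The digraph of a matrix `A` has an edge from `j` to `i` exactly when `A i j ≠ 0`. -/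

section CycleGains

variable {V : Type*} [Fintype V] [DecidableEq V]

/-- The simple cycles `(i₁, …, i_k, i₁)` of the digraph of `A`: lists of nodes up to cyclic
rotation, without repetition, with at least two nodes (self loops are excluded), in which any two
cyclically consecutive nodes `j`, `i` are joined by an edge from `j` to `i`. -/
abbrev SimpleCycle (A : Matrix V V ℝ) : Type _ :=
  {c : {s : Cycle V // s.Nodup ∧ s.Nontrivial} // c.1.Chain fun j i => A i j ≠ 0}

instance (A : Matrix V V ℝ) : Fintype (SimpleCycle A) := by
  classical exact inferInstance

namespace SimpleCycle

variable {A : Matrix V V ℝ}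

/-- The set of nodes of a simple cycle. -/
def nodes (c : SimpleCycle A) : Finset V := c.1.1.toFinset

/-- The map that sends each node of the cycle to the next one along the cycle
(and fixes all the other nodes). -/
def succ (c : SimpleCycle A) : Equiv.Perm V := c.1.1.formPerm c.1.2.1

/-- The sum-cycle gain `(a_{i₂i₁} / -a_{i₂i₂}) (a_{i₃i₂} / -a_{i₃i₃}) ⋯ (a_{i₁i_k} / -a_{i₁i₁})`
of the cycle `(i₁, …, i_k, i₁)`. -/
def gain (c : SimpleCycle A) : ℝ :=
  ∏ v ∈ c.nodes, A (c.succ v) v / -A (c.succ v) (c.succ v)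

end SimpleCycle

open Classical in
/-- The disjoint cycle set `K_ℓ`: all sets of `ℓ` simple cycles that are pairwise disjoint. -/
def disjointCycleSet (A : Matrix V V ℝ) (l : ℕ) : Finset (Finset (SimpleCycle A)) :=
  ((Finset.univ : Finset (SimpleCycle A)).powersetCard l).filter fun K =>
    ∀ c ∈ K, ∀ c' ∈ K, c ≠ c' → Disjoint c.nodes c'.nodes

/-- The total cycle gain `∑_{ℓ=1}^r ∑_{K ∈ K_ℓ} (-1)^(ℓ-1) ∏_{c ∈ K} γ_c`, where `r` is the number
of simple cycles; it is `0` if there is no simple cycle. -/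
def totalCycleGain (A : Matrix V V ℝ) : ℝ :=
  ∑ l ∈ Finset.Icc 1 (Fintype.card (SimpleCycle A)),
    ∑ K ∈ disjointCycleSet A l, (-1) ^ (l - 1) * ∏ c ∈ K, c.gain

end CycleGains

/-- The leading principal submatrix with rows and columns `0, …, i`. -/
def leadingPrincipal {n : ℕ} (A : Matrix (Fin n) (Fin n) ℝ) (i : Fin n) :
    Matrix (Fin (i + 1)) (Fin (i + 1)) ℝ :=
  A.submatrix (Fin.castLE i.isLt) (Fin.castLE i.isLt)

/-! ### Interconnected systems -/

open Classical in
/-- A network of `n` interconnected scalar systems `ẋᵢ = fᵢ(xᵢ, x_{𝒩ᵢ})`, where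
`𝒩ᵢ = {j | (j, i) is an edge}` and every `fᵢ` is continuously differentiable. -/
structure InterconnectedSystem (n : ℕ) where
  graph : Digraph (Fin n)
  loopless : ∀ i, ¬ graph.Adj i i
  f : ∀ i : Fin n, ℝ × ({j // graph.Adj j i} → ℝ) → ℝ
  contDiff : ∀ i, ContDiff ℝ 1 (f i)

namespace InterconnectedSystem

variable {n : ℕ} (S : InterconnectedSystem n)

/-- The vector field `f` on `ℝⁿ` of the whole network. -/
def field (x : EuclideanSpace ℝ (Fin n)) : EuclideanSpace ℝ (Fin n) :=
  WithLp.toLp 2 fun i => S.f i (x i, fun j => x j)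

/-- The Jacobian matrix `J(x)`, with entries `∂fᵢ/∂xⱼ (x)`. -/
def jacobian (x : EuclideanSpace ℝ (Fin n)) : Matrix (Fin n) (Fin n) ℝ :=
  Matrix.of fun i j => fderiv ℝ S.field x (EuclideanSpace.single j 1) i

open Classical in
/-- The comparison matrix: `γᵢⱼ` if `(j, i)` is an edge, `-1` on the diagonal, `0` elsewhere. -/
def comparisonMatrix (γ : Fin n → Fin n → ℝ) : Matrix (Fin n) (Fin n) ℝ :=
  Matrix.of fun i j => if S.graph.Adj j i then γ i j else if i = j then -1 else 0

end InterconnectedSystem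

/-- The nonnegative orthant of `ℝⁿ`. -/
def orthant (n : ℕ) : Set (EuclideanSpace ℝ (Fin n)) := {x | ∀ i, 0 ≤ x i}

/-! ### Global asymptotic stability -/

section Stability

variable {E : Type*} [NormedAddCommGroup E] [NormedSpace ℝ E]

/-- `x` restricted to `[0, ∞)` is a solution of `ẋ = F(x)` (one-sided derivative at time `0`). -/
def IsForwardSolution (F : E → E) (x : ℝ → E) : Prop :=
  ∀ t, 0 ≤ t → HasDerivWithinAt x (F (x t)) (Ici 0) t

/-- The point `p` is globally asymptotically stable for the system `ẋ = F(x)` evolving on `X`: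
it is an equilibrium in `X`, solutions starting in `X` exist for all positive times and stay in
`X`, `p` is Lyapunov stable, and `p` attracts all solutions starting in `X`. -/
structure IsGloballyAsymptoticallyStable (F : E → E) (X : Set E) (p : E) : Prop where
  mem : p ∈ X
  equilibrium : F p = 0
  exists_solution : ∀ x₀ ∈ X, ∃ x : ℝ → E, x 0 = x₀ ∧ IsForwardSolution F x
  invariant : ∀ x : ℝ → E, IsForwardSolution F x → x 0 ∈ X → ∀ t, 0 ≤ t → x t ∈ X
  stable : ∀ ε > 0, ∃ δ > 0, ∀ x : ℝ → E, IsForwardSolution F x → x 0 ∈ X → ‖x 0 - p‖ < δ →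
    ∀ t, 0 ≤ t → ‖x t - p‖ < ε
  attractive : ∀ x : ℝ → E, IsForwardSolution F x → x 0 ∈ X → Tendsto x atTop (𝓝 p)

end Stability

end

/-! In the Leibniz expansion of `det (-A)`, with diagonal of `A` equal to `-1`, each permutation
splits into disjoint cycles and each cycle contributes minus its gain, so `det (-A) = 1 -
totalCycleGain A`. The gain condition thus says that the Z-matrix `-M` has positive leading
principal minors, and `exists_pos_mulVec_pos` yields `d > 0` with `M d < 0`.

Since `J ≤ diag(-Jᵢᵢ) M` entrywise, `J(x) d < 0` on the orthant. Integrating along the ray through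
`d` from `f(0) = 0` gives `f(s d) < 0` for every `s > 0`. The Metzler property makes `f`
cooperative, so every box `[0, s d]` is forward invariant. This gives existence, invariance and
stability. Convergence follows because the upper corner `s d` may be lowered at a positive speed
while `s` stays in a compact subset of `(0, ∞)`. -/

/-! ### Determinants and cycle gains -/

section CycleExpansion

variable {V : Type*} [Fintype V] [DecidableEq V]

-- Turns the edge condition on a cycle into a condition on single entries `A (σ v) v`, as they occur
-- in the determinant.
omit [Fintype V] in
theorem Cycle.chain_iff_forall_formPerm {r : V → V → Prop} (s : Cycle V) (h : s.Nodup) :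
    s.Chain r ↔ ∀ v ∈ s, r v (s.formPerm h v) := by
  induction s using Quotient.inductionOn with
  | _ l =>
    rcases l with _ | ⟨a, l⟩
    · simp
    · have hl : (a :: l).Nodup := h
      change Cycle.Chain r ((a :: l : List V) : Cycle V) ↔
        ∀ v ∈ a :: l, r v ((a :: l).formPerm v)
      rw [Cycle.chain_coe_cons, List.isChain_iff_getElem]
      have key : ∀ i (hi : i < l.length + 1),
          (a :: (l ++ [a]))[i + 1]'(by simp; omega) = (a :: l).formPerm (a :: l)[i] := by
        intro i hi
        rw [List.formPerm_apply_getElem _ hl]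
        rcases Nat.lt_succ_iff_lt_or_eq.mp hi with h' | h'
        · have : (i + 1) % (a :: l).length = i + 1 := Nat.mod_eq_of_lt (by simpa using h')
          simp only [this, List.getElem_cons_succ, List.getElem_append_left h']
        · subst h'
          simp
      have key' : ∀ i (hi : i < l.length + 1),
          (a :: (l ++ [a]))[i]'(by simp; omega) = (a :: l)[i] := by
        intro i hi
        exact List.getElem_append_left (as := a :: l) (bs := [a]) hi
      constructor
      · intro H v hv
        obtain ⟨i, hi, rfl⟩ := List.getElem_of_mem hv
        have := H i (by simpa using hi)
        rwa [key i hi, key' i hi] at this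
      · intro H i hi
        have hi' : i < l.length + 1 := by simpa using hi
        rw [key i hi', key' i hi']
        exact H _ (List.getElem_mem _)

omit [Fintype V] in
theorem Cycle.mem_toFinset_iff {v : V} (s : Cycle V) : v ∈ s.toFinset ↔ v ∈ s := by
  induction s using Quotient.inductionOn with
  | _ l => exact List.mem_toFinset

/-- A cycle of length `k` has sign `(-1)^(k-1)` and its `k` entries of `-A` bring `(-1)^k`, so one
minus sign per cycle survives. Fixed points contribute `1`. -/
theorem Equiv.Perm.sign_mul_prod_neg (A : Matrix V V ℝ) (hA : ∀ i, A i i = -1)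
    (σ : Equiv.Perm V) :
    ((Equiv.Perm.sign σ : ℤ) : ℝ) * ∏ v, (-A) (σ v) v =
      ∏ c ∈ σ.cycleFactorsFinset, -∏ v ∈ c.support, A (c v) v := by
  have h_sign : Equiv.Perm.sign σ = ∏ c ∈ σ.cycleFactorsFinset, Equiv.Perm.sign c := by
    conv_lhs => rw [← Equiv.Perm.cycleFactorsFinset_noncommProd σ]
    rw [Finset.map_noncommProd, Finset.noncommProd_eq_prod]
    rfl
  have h_supp : σ.support = σ.cycleFactorsFinset.biUnion Equiv.Perm.support := by
    ext v
    simp only [Finset.mem_biUnion]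
    exact Equiv.Perm.mem_support_iff_mem_support_of_mem_cycleFactorsFinset
  have h_prod : ∏ v, (-A) (σ v) v =
      ∏ c ∈ σ.cycleFactorsFinset, ∏ v ∈ c.support, (-A) (c v) v := by
    rw [← Finset.prod_subset (Finset.subset_univ σ.support), h_supp, Finset.prod_biUnion]
    · refine Finset.prod_congr rfl fun c hc => Finset.prod_congr rfl fun v hv => ?_
      rw [(Equiv.Perm.mem_cycleFactorsFinset_iff.mp hc).2 v hv]
    · intro c hc c' hc' hne
      exact (Equiv.Perm.cycleFactorsFinset_pairwise_disjoint σ hc hc' hne).disjoint_support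
    · intro v _ hv
      rw [Equiv.Perm.notMem_support.mp hv]
      simp [hA]
  rw [h_sign, h_prod]
  push_cast
  rw [← Finset.prod_mul_distrib]
  refine Finset.prod_congr rfl fun c hc => ?_
  rw [(Equiv.Perm.mem_cycleFactorsFinset_iff.mp hc).1.sign]
  simp only [Matrix.neg_apply, Finset.prod_neg]
  push_cast
  have : ((-1 : ℝ) ^ c.support.card) * (-1) ^ c.support.card = 1 := by
    rw [← mul_pow]; simp
  linear_combination (-∏ v ∈ c.support, A (c v) v) * this

namespace SimpleCycle

variable {A : Matrix V V ℝ}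

theorem succ_injective : Function.Injective (succ : SimpleCycle A → Equiv.Perm V) := by
  intro c c' h
  apply Subtype.ext
  apply Equiv.Perm.isoCycle.symm.injective
  exact Subtype.ext h

omit [Fintype V] in
theorem isCycle_succ (c : SimpleCycle A) : c.succ.IsCycle :=
  Cycle.isCycle_formPerm _ _ c.1.2.2

theorem support_succ (c : SimpleCycle A) : c.succ.support = c.nodes :=
  Cycle.support_formPerm _ _ c.1.2.2

theorem gain_eq (hA : ∀ i, A i i = -1) (c : SimpleCycle A) :
    c.gain = ∏ v ∈ c.succ.support, A (c.succ v) v := by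
  rw [support_succ]
  simp [gain, hA]

theorem exists_succ_eq {σ : Equiv.Perm V} (hσ : σ.IsCycle)
    (h : ∀ v ∈ σ.support, A (σ v) v ≠ 0) : ∃ c : SimpleCycle A, c.succ = σ := by
  have h1 : (Equiv.Perm.isoCycle ⟨σ, hσ⟩).1.formPerm (Equiv.Perm.isoCycle ⟨σ, hσ⟩).2.1 = σ :=
    congrArg Subtype.val (Equiv.Perm.isoCycle.symm_apply_apply ⟨σ, hσ⟩)
  refine ⟨⟨Equiv.Perm.isoCycle ⟨σ, hσ⟩, ?_⟩, h1⟩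
  rw [Cycle.chain_iff_forall_formPerm _ (Equiv.Perm.isoCycle ⟨σ, hσ⟩).2.1]
  intro v hv
  rw [h1]
  apply h
  have := Cycle.support_formPerm _ (Equiv.Perm.isoCycle ⟨σ, hσ⟩).2.1
    (Equiv.Perm.isoCycle ⟨σ, hσ⟩).2.2
  rw [h1] at this
  rw [this]
  exact (Cycle.mem_toFinset_iff _).mpr hv

end SimpleCycle

-- Disjoint cyclic permutations commute, and their product has exactly them as cycle factors.
open Classical in
theorem exists_cycleFactorsFinset_eq_image {A : Matrix V V ℝ} (K : Finset (SimpleCycle A))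
    (hK : ∀ c ∈ K, ∀ c' ∈ K, c ≠ c' → Disjoint c.nodes c'.nodes) :
    ∃ σ : Equiv.Perm V, σ.cycleFactorsFinset = K.image SimpleCycle.succ := by
  have h : ((K.image SimpleCycle.succ : Finset (Equiv.Perm V)) : Set (Equiv.Perm V)).Pairwise
      Equiv.Perm.Disjoint := by
    intro σ hσ τ hτ hne
    simp only [Finset.coe_image, Set.mem_image, Finset.mem_coe] at hσ hτ
    obtain ⟨c, hc, rfl⟩ := hσ
    obtain ⟨c', hc', rfl⟩ := hτ
    rw [Equiv.Perm.disjoint_iff_disjoint_support, SimpleCycle.support_succ,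
      SimpleCycle.support_succ]
    exact hK c hc c' hc' fun h => hne (h ▸ rfl)
  refine ⟨_, Equiv.Perm.cycleFactorsFinset_eq_finset.mpr ⟨?_, h, rfl⟩⟩
  intro σ hσ
  obtain ⟨c, _, rfl⟩ := Finset.mem_image.mp hσ
  exact c.isCycle_succ

-- Families of disjoint simple cycles embed into permutations through their cycle factors; the
-- permutations that are missed have a zero Leibniz term.
open Classical in
theorem det_neg_eq_sum_disjoint (A : Matrix V V ℝ) (hA : ∀ i, A i i = -1) :
    (-A).det = ∑ K ∈ (Finset.univ : Finset (Finset (SimpleCycle A))).filter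
      (fun K => ∀ c ∈ K, ∀ c' ∈ K, c ≠ c' → Disjoint c.nodes c'.nodes),
      ∏ c ∈ K, -c.gain := by
  choose! e he using exists_cycleFactorsFinset_eq_image (A := A)
  rw [Matrix.det_apply']
  symm
  apply Finset.sum_of_injOn e
  · intro K hK K' hK' h
    have hK := he K (Finset.mem_filter.mp hK).2
    have hK' := he K' (Finset.mem_filter.mp hK').2
    rw [h, hK'] at hK
    exact (Finset.image_injective SimpleCycle.succ_injective hK).symm
  · intro K _
    simp
  · intro σ _ hσ
    rw [Equiv.Perm.sign_mul_prod_neg A hA]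
    -- A nonzero term forces every cycle factor to run along edges, so the permutation comes from a
    -- family of simple cycles.
    by_contra hne
    rw [← ne_eq, Finset.prod_ne_zero_iff] at hne
    apply hσ
    have hcyc : ∀ c ∈ σ.cycleFactorsFinset, ∃ c' : SimpleCycle A, c'.succ = c := by
      intro c hc
      refine SimpleCycle.exists_succ_eq (Equiv.Perm.mem_cycleFactorsFinset_iff.mp hc).1 ?_
      exact Finset.prod_ne_zero_iff.mp (neg_ne_zero.mp (hne c hc))
    obtain ⟨K, hK⟩ : ∃ K : Finset (SimpleCycle A), ∀ c, c ∈ K ↔ c.succ ∈ σ.cycleFactorsFinset :=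
      ⟨Finset.univ.filter fun c => c.succ ∈ σ.cycleFactorsFinset, fun c => by
        rw [Finset.mem_filter, and_iff_right (Finset.mem_univ c)]⟩
    have himg : K.image SimpleCycle.succ = σ.cycleFactorsFinset := by
      ext c
      rw [Finset.mem_image]
      constructor
      · rintro ⟨c', h, rfl⟩
        exact (hK c').mp h
      · intro h
        obtain ⟨c', rfl⟩ := hcyc c h
        exact ⟨c', (hK c').mpr h, rfl⟩
    have hdisj : ∀ c ∈ K, ∀ c' ∈ K, c ≠ c' → Disjoint c.nodes c'.nodes := by
      intro c hc c' hc' hne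
      rw [← SimpleCycle.support_succ, ← SimpleCycle.support_succ]
      exact (Equiv.Perm.cycleFactorsFinset_pairwise_disjoint σ ((hK c).mp hc) ((hK c').mp hc')
        fun h => hne (SimpleCycle.succ_injective h)).disjoint_support
    refine ⟨K, ?_, Equiv.Perm.cycleFactorsFinset_injective ((he K hdisj).trans himg)⟩
    rw [Finset.mem_coe, Finset.mem_filter]
    exact ⟨Finset.mem_univ _, hdisj⟩
  · intro K hK
    rw [Equiv.Perm.sign_mul_prod_neg A hA, he K (Finset.mem_filter.mp hK).2,
      Finset.prod_image SimpleCycle.succ_injective.injOn]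
    exact Finset.prod_congr rfl fun c _ => by rw [SimpleCycle.gain_eq hA]

/-- The determinant of `-A` for a matrix `A` with diagonal entries `-1`, in terms of cycles. -/
theorem det_neg_eq_one_sub_totalCycleGain (A : Matrix V V ℝ) (hA : ∀ i, A i i = -1) :
    (-A).det = 1 - totalCycleGain A := by
  classical
  have h : ∀ l, ∑ K ∈ disjointCycleSet A l, ∏ c ∈ K, -c.gain =
      (-1) ^ l * ∑ K ∈ disjointCycleSet A l, ∏ c ∈ K, c.gain := by
    intro l
    rw [Finset.mul_sum]
    refine Finset.sum_congr rfl fun K hK => ?_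
    have : K.card = l := by
      simp only [disjointCycleSet, Finset.mem_filter, Finset.mem_powersetCard] at hK
      exact hK.1.2
    rw [Finset.prod_neg, this]
  -- The empty family, absent from the total gain, supplies the `1`.
  have h0 : ∑ K ∈ disjointCycleSet A 0, ∏ c ∈ K, -c.gain = 1 := by
    simp [disjointCycleSet, Finset.powersetCard_zero, Finset.filter_singleton]
  rw [det_neg_eq_sum_disjoint A hA, ← Finset.powerset_univ, Finset.sum_filter,
    Finset.sum_powerset]
  rw [Finset.card_univ, Finset.range_eq_Ico, Finset.sum_eq_sum_Ico_succ_bot (Nat.succ_pos _)]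
  simp only [← Finset.sum_filter]
  have h1 : ∀ l, ∑ K ∈ ((Finset.univ : Finset (SimpleCycle A)).powersetCard l).filter (fun K =>
      ∀ c ∈ K, ∀ c' ∈ K, c ≠ c' → Disjoint c.nodes c'.nodes), ∏ c ∈ K, -c.gain =
      ∑ K ∈ disjointCycleSet A l, ∏ c ∈ K, -c.gain := fun l => by
    refine Finset.sum_congr ?_ fun _ _ => rfl
    ext K
    simp [disjointCycleSet]
  simp only [h1, h0]
  rw [sub_eq_add_neg, totalCycleGain, ← Finset.sum_neg_distrib]
  refine congrArg (1 + ·) (Finset.sum_congr ?_ fun l hl => ?_)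
  · ext l
    simp only [Finset.mem_Ico, Finset.mem_Icc]
    omega
  · have hl' : 1 ≤ l := by
      simp only [Finset.mem_Icc] at hl
      omega
    obtain ⟨k, rfl⟩ := Nat.exists_eq_add_of_le' hl'
    rw [h, ← Finset.mul_sum, pow_succ]
    simp

end CycleExpansion
-- M-matrices
section MMatrix

/-- If the least ratio `s = u k / d k` were negative, then `u ≥ s d` with equality at `k`, and the
signs of `B` would give `(B u) k ≤ s (B d) k < 0`. -/
theorem nonneg_of_mulVec_nonneg {V : Type*} [Fintype V] {B : Matrix V V ℝ}
    (hB : ∀ i j, i ≠ j → B i j ≤ 0) {d : V → ℝ} (hd : ∀ i, 0 < d i)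
    (hBd : ∀ i, 0 < B.mulVec d i) {u : V → ℝ} (hu : ∀ i, 0 ≤ B.mulVec u i) (i : V) :
    0 ≤ u i := by
  classical
  obtain ⟨k, -, hk⟩ := Finset.exists_min_image Finset.univ (fun j => u j / d j)
    ⟨i, Finset.mem_univ i⟩
  by_contra! hneg
  set s := u k / d k with hs
  have hs0 : s < 0 := (hk i (Finset.mem_univ i)).trans_lt (div_neg_of_neg_of_pos hneg (hd i))
  have hle : B.mulVec u k ≤ s * B.mulVec d k := by
    simp only [Matrix.mulVec, dotProduct, Finset.mul_sum]
    refine Finset.sum_le_sum fun j _ => ?_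
    have hj : s * d j ≤ u j := (le_div_iff₀ (hd j)).mp (hk j (Finset.mem_univ j))
    rcases eq_or_ne k j with rfl | hkj
    · have : u k = s * d k := (div_mul_cancel₀ _ (hd k).ne').symm
      rw [this]
      exact le_of_eq (by ring)
    · nlinarith [mul_le_mul_of_nonpos_left hj (hB k j hkj)]
  exact absurd (hu k) (not_le.mpr (hle.trans_lt (mul_neg_of_neg_of_pos hs0 (hBd k))))

/-- Replacing the last column by `A x` keeps the determinant because `x` has last entry `1`;
expanding along this column leaves one term. It is the Schur complement formula without an inverse.
-/
theorem det_eq_mul_det_submatrix_castSucc {n : ℕ} (A : Matrix (Fin (n + 1)) (Fin (n + 1)) ℝ)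
    {x : Fin (n + 1) → ℝ} (hx : x (Fin.last n) = 1)
    (hAx : ∀ i : Fin n, A.mulVec x i.castSucc = 0) :
    A.det = A.mulVec x (Fin.last n) * (A.submatrix Fin.castSucc Fin.castSucc).det := by
  have h : (A.updateCol (Fin.last n) (A.mulVec x)).det = A.det := by
    have := Matrix.det_updateCol_sum A (Fin.last n) x
    rw [hx, one_smul] at this
    rw [← this]
    congr 2
    ext i
    simp [Matrix.mulVec, dotProduct, mul_comm]
  rw [← h, Matrix.det_succ_column _ (Fin.last n), Fin.sum_univ_castSucc, Finset.sum_eq_zero]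
  · have : (A.updateCol (Fin.last n) (A.mulVec x)).submatrix Fin.castSucc Fin.castSucc =
        A.submatrix Fin.castSucc Fin.castSucc := by
      ext i j
      simp [(Fin.castSucc_lt_last j).ne]
    have hsign : (-1 : ℝ) ^ (n + n) = 1 := Even.neg_one_pow ⟨n, rfl⟩
    simp [Fin.succAbove_last, this, hsign]
  · intro i _
    simp [hAx]

/-- A Z-matrix with positive leading principal minors is a nonsingular M-matrix. -/
theorem exists_pos_mulVec_pos {n : ℕ} (A : Matrix (Fin n) (Fin n) ℝ)
    (hA : ∀ i j, i ≠ j → A i j ≤ 0) (hdet : ∀ i, 0 < (leadingPrincipal A i).det) :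
    ∃ d : Fin n → ℝ, (∀ i, 0 < d i) ∧ ∀ i, 0 < A.mulVec d i := by
  induction n with
  | zero => exact ⟨fun _ => 1, fun i => i.elim0, fun i => i.elim0⟩
  | succ n ih =>
    set B := A.submatrix Fin.castSucc Fin.castSucc with hBdef
    have hBneg : ∀ i j, i ≠ j → B i j ≤ 0 := fun i j hij =>
      hA _ _ fun h => hij (Fin.castSucc_injective n h)
    obtain ⟨d, hd, hBd⟩ := ih B hBneg fun i => hdet i.castSucc
    have hdetA : 0 < A.det := hdet (Fin.last n)
    -- The empty minor is not among the hypotheses, hence the separate case of size zero.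
    have hdetB : 0 ≤ B.det := by
      rcases n with _ | n
      · simp
      · exact (hdet (Fin.last n).castSucc).le
    obtain ⟨u, hu⟩ : ∃ u, B.mulVec u = fun i => -A i.castSucc (Fin.last n) := by
      have hB : IsUnit B.det := by
        rcases n with _ | n
        · simp
        · exact (hdet (Fin.last n).castSucc).ne'.isUnit
      exact ⟨B⁻¹.mulVec _, by rw [Matrix.mulVec_mulVec, Matrix.mul_nonsing_inv _ hB,
        Matrix.one_mulVec]⟩
    have hu0 : ∀ i, 0 ≤ u i := nonneg_of_mulVec_nonneg hBneg hd hBd fun i => by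
      rw [hu]
      exact neg_nonneg.mpr (hA _ _ (Fin.castSucc_lt_last i).ne)
    have hmul : ∀ (w : Fin n → ℝ) (i : Fin (n + 1)),
        A.mulVec (Fin.snoc w 1 : Fin (n + 1) → ℝ) i =
          (∑ j, A i j.castSucc * w j) + A i (Fin.last n) := fun w i => by
      simp [Matrix.mulVec, dotProduct, Fin.sum_univ_castSucc]
    -- This is the Schur complement, positive because `det A > 0` and `det B ≥ 0`.
    have hlast : 0 < (∑ j, A (Fin.last n) j.castSucc * u j) + A (Fin.last n) (Fin.last n) := by
      have := det_eq_mul_det_submatrix_castSucc A (x := Fin.snoc u 1) (by simp) fun i => by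
        rw [hmul]
        have := congrFun hu i
        simp only [Matrix.mulVec, dotProduct, B, Matrix.submatrix_apply] at this
        rw [this]
        ring
      rw [hmul] at this
      rw [this] at hdetA
      exact pos_of_mul_pos_left hdetA hdetB
    obtain ⟨ε, hε, hεlt⟩ : ∃ ε > 0, 0 < (∑ j, A (Fin.last n) j.castSucc * u j) +
        A (Fin.last n) (Fin.last n) + ε * ∑ j, A (Fin.last n) j.castSucc * d j := by
      set α := (∑ j, A (Fin.last n) j.castSucc * u j) + A (Fin.last n) (Fin.last n)
      set β := ∑ j, A (Fin.last n) j.castSucc * d j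
      have hβ : 0 < |β| + 1 := by positivity
      refine ⟨α / (|β| + 1), by positivity, ?_⟩
      have h1 : α / (|β| + 1) * (|β| + 1) = α := div_mul_cancel₀ _ hβ.ne'
      have h2 : 0 < α / (|β| + 1) := by positivity
      nlinarith [neg_abs_le β]
    -- With `(u, 1)` the upper rows vanish; adding `ε d` makes them `ε B d > 0`, and `ε` is small
    -- enough to keep the last row positive.
    refine ⟨Fin.snoc (fun j => u j + ε * d j) 1, fun i => ?_, fun i => ?_⟩
    · refine Fin.lastCases ?_ (fun j => ?_) i
      · simp
      · simpa using add_pos_of_nonneg_of_pos (hu0 j) (mul_pos hε (hd j))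
    · rw [hmul]
      have hsum : ∀ i, ∑ j, A i j.castSucc * (u j + ε * d j) =
          ∑ j, A i j.castSucc * u j + ε * ∑ j, A i j.castSucc * d j := fun i => by
        rw [Finset.mul_sum, ← Finset.sum_add_distrib]
        exact Finset.sum_congr rfl fun j _ => by ring
      rw [hsum]
      refine Fin.lastCases ?_ (fun k => ?_) i
      · linarith
      · have h1 := congrFun hu k
        have h2 := hBd k
        simp only [Matrix.mulVec, dotProduct, B, Matrix.submatrix_apply] at h1 h2
        rw [h1]
        linarith [mul_pos hε h2]

end MMatrix
-- A comparison principle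
section Comparison

/-- A finite family of functions whose one-sided derivatives are negative wherever they reach `0`
from below stays nonpositive. -/
theorem forall_nonpos_of_deriv_neg_of_eq_zero {ι : Type*} [Finite ι] {a b : ℝ}
    {g g' : ι → ℝ → ℝ} (hg : ∀ i, ContinuousOn (g i) (Icc a b))
    (hg' : ∀ i, ∀ t ∈ Ico a b, HasDerivWithinAt (g i) (g' i t) (Ici t) t)
    (ha : ∀ i, g i a ≤ 0)
    (h : ∀ t ∈ Ico a b, (∀ j, g j t ≤ 0) → ∀ i, g i t = 0 → g' i t < 0) :
    ∀ t ∈ Icc a b, ∀ i, g i t ≤ 0 := by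
  have hclosed : IsClosed ({t | ∀ i, g i t ≤ 0} ∩ Icc a b) := by
    rw [show {t | ∀ i, g i t ≤ 0} ∩ Icc a b = (⋂ i, (Icc a b ∩ (g i) ⁻¹' Iic 0)) ∩ Icc a b by
      ext t
      simp only [mem_inter_iff, mem_iInter, mem_preimage, Set.mem_Iic]
      exact ⟨fun h => ⟨fun i => ⟨h.2, h.1 i⟩, h.2⟩, fun h => ⟨fun i => (h.1 i).2, h.2⟩⟩]
    exact (isClosed_iInter fun i => (hg i).preimage_isClosed_of_isClosed isClosed_Icc
      isClosed_Iic).inter isClosed_Icc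
  -- Continuous induction: a closed condition that persists a little to the right of each point
  -- holds on the whole interval.
  refine fun t ht => hclosed.Icc_subset_of_forall_mem_nhdsWithin ha ?_ ht
  rintro t ⟨hle, ht⟩
  change ∀ᶠ s in 𝓝[>] t, ∀ i, g i s ≤ 0
  rw [eventually_all]
  intro i
  rcases (hle i).lt_or_eq with hlt | heq
  · have := ((hg' i t ht).continuousWithinAt.mono Ioi_subset_Ici_self).eventually_lt_const hlt
    exact this.mono fun s hs => hs.le
  · have hslope := (hasDerivWithinAt_iff_tendsto_slope' (by simp)).mp
      ((hg' i t ht).mono Ioi_subset_Ici_self)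
    filter_upwards [hslope.eventually_lt_const (h t ht hle i heq), self_mem_nhdsWithin]
      with s hs hts
    rw [slope_def_field, heq, sub_zero, div_lt_iff₀ (sub_pos.mpr hts), zero_mul] at hs
    exact hs.le

end Comparison

/-! ### Uniqueness and global existence -/

section ForwardSolutions

variable {E : Type*} [NormedAddCommGroup E] [NormedSpace ℝ E]

theorem IsForwardSolution.hasDerivWithinAt_Ici {F : E → E} {x : ℝ → E}
    (hx : IsForwardSolution F x) {t : ℝ} (ht : 0 ≤ t) :
    HasDerivWithinAt x (F (x t)) (Ici t) t :=
  (hx t ht).mono (Ici_subset_Ici.mpr ht)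

theorem IsForwardSolution.continuousOn {F : E → E} {x : ℝ → E}
    (hx : IsForwardSolution F x) : ContinuousOn x (Ici 0) :=
  fun t ht => (hx t ht).continuousWithinAt

/-- Uniqueness of solutions of a locally Lipschitz system. -/
theorem IsForwardSolution.eqOn [FiniteDimensional ℝ E] {F : E → E} (hF : ContDiff ℝ 1 F)
    {x y : ℝ → E} (hx : IsForwardSolution F x) (hy : IsForwardSolution F y) (h0 : x 0 = y 0) :
    EqOn x y (Ici 0) := by
  intro T hT
  have hxc : ContinuousOn x (Icc 0 T) := hx.continuousOn.mono Icc_subset_Ici_self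
  have hyc : ContinuousOn y (Icc 0 T) := hy.continuousOn.mono Icc_subset_Ici_self
  -- Both trajectories up to time `T` lie in one compact set, where a single Lipschitz constant is
  -- available.
  set s := x '' Icc 0 T ∪ y '' Icc 0 T
  have hs : IsCompact s := (isCompact_Icc.image_of_continuousOn hxc).union
    (isCompact_Icc.image_of_continuousOn hyc)
  obtain ⟨K, hK⟩ :=
    (hF.locallyLipschitz.locallyLipschitzOn (s := s)).exists_lipschitzOnWith_of_compact hs
  exact ODE_solution_unique_of_mem_Icc_right (v := fun _ => F) (s := fun _ => s) (fun _ _ => hK)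
    hxc (fun t ht => hx.hasDerivWithinAt_Ici ht.1)
    (fun t ht => Or.inl (mem_image_of_mem x (Ico_subset_Icc_self ht)))
    hyc (fun t ht => hy.hasDerivWithinAt_Ici ht.1)
    (fun t ht => Or.inr (mem_image_of_mem y (Ico_subset_Icc_self ht))) h0 ⟨hT, le_rfl⟩

/-- A bounded globally Lipschitz vector field has global forward solutions. -/
theorem exists_isForwardSolution_of_lipschitzWith [CompleteSpace E] {F : E → E} {K : NNReal}
    (hF : LipschitzWith K F) {C : NNReal} (hC : ∀ x, ‖F x‖ ≤ C) (x₀ : E) :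
    ∃ x : ℝ → E, x 0 = x₀ ∧ IsForwardSolution F x := by
  have hloc : ∀ N : ℕ, ∃ x : ℝ → E, x 0 = x₀ ∧
      ∀ t ∈ Icc (0 : ℝ) N, HasDerivWithinAt x (F (x t)) (Icc 0 N) t := by
    intro N
    -- Speed at most `C` during time `N` cannot leave the ball of radius `C * N`.
    exact (IsPicardLindelof.of_time_independent (t₀ := (⟨0, le_rfl, N.cast_nonneg⟩ : Icc (0 : ℝ) N))
      (x₀ := x₀) (a := C * N) (r := 0) (fun x _ => hC x) hF.lipschitzOnWith
      (by simp)).exists_eq_forall_mem_Icc_hasDerivWithinAt₀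
  choose y hy0 hy using hloc
  have hcons : ∀ M N : ℕ, M ≤ N → EqOn (y M) (y N) (Icc 0 M) := by
    intro M N hMN
    have hMN' : (M : ℝ) ≤ N := by exact_mod_cast hMN
    have hder : ∀ L : ℕ, M ≤ L → ∀ t ∈ Ico (0 : ℝ) M,
        HasDerivWithinAt (y L) (F (y L t)) (Ici t) t := by
      intro L hL t ht
      have hL' : (M : ℝ) ≤ L := by exact_mod_cast hL
      refine (hy L t ⟨ht.1, ht.2.le.trans hL'⟩).mono_of_mem_nhdsWithin ?_
      exact mem_of_superset (Icc_mem_nhdsGE (ht.2.trans_le hL')) (Icc_subset_Icc_left ht.1)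
    have hcont : ∀ L : ℕ, M ≤ L → ContinuousOn (y L) (Icc 0 M) := fun L hL =>
      ContinuousOn.mono (fun t ht => (hy L t ht).continuousWithinAt)
        (Icc_subset_Icc_right (by exact_mod_cast hL))
    exact ODE_solution_unique_of_mem_Icc_right (v := fun _ => F) (s := fun _ => univ)
      (fun _ _ => hF.lipschitzOnWith) (hcont M le_rfl) (hder M le_rfl) (fun _ _ => mem_univ _)
      (hcont N hMN) (hder N hMN) (fun _ _ => mem_univ _) ((hy0 M).trans (hy0 N).symm)
  -- The `+ 1` keeps `t` strictly below the right end of the interval, so the derivative is taken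
  -- within `[0, ∞)`.
  refine ⟨fun t => y (⌊t⌋₊ + 1) t, hy0 _, fun t ht => ?_⟩
  have hlt : t < (⌊t⌋₊ + 1 : ℕ) := by exact_mod_cast Nat.lt_floor_add_one t
  set N := ⌊t⌋₊ + 1 with hN
  have hnhds : Icc (0 : ℝ) N ∈ 𝓝[Ici 0] t := by
    rw [mem_nhdsWithin]
    exact ⟨Iio N, isOpen_Iio, hlt, fun s hs => ⟨hs.2, le_of_lt hs.1⟩⟩
  refine ((hy N t ⟨ht, hlt.le⟩).mono_of_mem_nhdsWithin hnhds).congr_of_eventuallyEq ?_ rfl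
  filter_upwards [hnhds, inter_mem_nhdsWithin (Ici 0) (Iio_mem_nhds hlt)] with s hs hs'
  refine hcons _ _ ?_ ⟨hs.1, ?_⟩
  · exact Nat.succ_le_of_lt ((Nat.floor_lt hs.1).mpr hs'.2)
  · exact_mod_cast (Nat.lt_floor_add_one s).le

end ForwardSolutions
-- Projection onto boxes
section Box

variable {n : ℕ}

theorem EuclideanSpace.norm_le_norm_of_abs_le {x y : EuclideanSpace ℝ (Fin n)}
    (h : ∀ i, |x i| ≤ |y i|) : ‖x‖ ≤ ‖y‖ := by
  rw [EuclideanSpace.norm_eq, EuclideanSpace.norm_eq]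
  refine Real.sqrt_le_sqrt (Finset.sum_le_sum fun i _ => ?_)
  exact pow_le_pow_left₀ (abs_nonneg _) (h i) 2

/-- The projection of `ℝⁿ` onto the box `{x | 0 ≤ x ≤ b}`. -/
noncomputable def clampBox (b x : EuclideanSpace ℝ (Fin n)) : EuclideanSpace ℝ (Fin n) :=
  WithLp.toLp 2 fun i => max 0 (min (x i) (b i))

theorem clampBox_apply (b x : EuclideanSpace ℝ (Fin n)) (i : Fin n) :
    clampBox b x i = max 0 (min (x i) (b i)) := rfl

theorem clampBox_mem_orthant (b x : EuclideanSpace ℝ (Fin n)) : clampBox b x ∈ orthant n :=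
  fun _ => le_max_left _ _

theorem clampBox_le {b : EuclideanSpace ℝ (Fin n)} (hb : b ∈ orthant n)
    (x : EuclideanSpace ℝ (Fin n)) (i : Fin n) : clampBox b x i ≤ b i :=
  max_le (hb i) (min_le_right _ _)

theorem clampBox_eq_self {b x : EuclideanSpace ℝ (Fin n)} (hx : x ∈ orthant n)
    (hxb : ∀ i, x i ≤ b i) : clampBox b x = x := by
  ext i
  rw [clampBox_apply, min_eq_left (hxb i), max_eq_right (hx i)]

theorem lipschitzWith_clampBox (b : EuclideanSpace ℝ (Fin n)) :
    LipschitzWith 1 (clampBox b) := by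
  refine LipschitzWith.of_dist_le_mul fun x y => ?_
  rw [dist_eq_norm, dist_eq_norm, NNReal.coe_one, one_mul]
  refine EuclideanSpace.norm_le_norm_of_abs_le fun i => ?_
  simp only [PiLp.sub_apply, clampBox_apply]
  refine (abs_max_sub_max_le_max _ _ _ _).trans ?_
  rw [sub_self, abs_zero, max_eq_right (abs_nonneg _)]
  refine (abs_min_sub_min_le_max _ _ _ _).trans ?_
  rw [sub_self, abs_zero, max_eq_left (abs_nonneg _)]

theorem norm_clampBox_le {b : EuclideanSpace ℝ (Fin n)} (hb : b ∈ orthant n)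
    (x : EuclideanSpace ℝ (Fin n)) : ‖clampBox b x‖ ≤ ‖b‖ :=
  EuclideanSpace.norm_le_norm_of_abs_le fun i => by
    rw [abs_of_nonneg (clampBox_mem_orthant b x i), abs_of_nonneg (hb i)]
    exact clampBox_le hb x i

theorem exists_pos_le_smul {d : EuclideanSpace ℝ (Fin n)} (hd : ∀ i, 0 < d i)
    (x : EuclideanSpace ℝ (Fin n)) : ∃ s > 0, ∀ i, x i ≤ s * d i := by
  have h : ∀ᶠ s : ℝ in atTop, ∀ i, x i ≤ s * d i :=
    eventually_all.mpr fun i => (tendsto_id.atTop_mul_const (hd i)).eventually_ge_atTop (x i)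
  obtain ⟨s, hs, hs0⟩ := (h.and (eventually_gt_atTop 0)).exists
  exact ⟨s, hs0, hs⟩

end Box

/-! ### Cooperative systems on the orthant -/

section Cooperative

variable {n : ℕ}

theorem IsForwardSolution.hasDerivWithinAt_apply
    {F : EuclideanSpace ℝ (Fin n) → EuclideanSpace ℝ (Fin n)}
    {x : ℝ → EuclideanSpace ℝ (Fin n)} (hx : IsForwardSolution F x) (i : Fin n) {t : ℝ}
    (ht : 0 ≤ t) : HasDerivWithinAt (fun t => x t i) (F (x t) i) (Ici t) t := by
  have := (EuclideanSpace.proj (𝕜 := ℝ) i).hasFDerivAt.comp_hasDerivWithinAt t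
    (hx.hasDerivWithinAt_Ici ht)
  exact this

theorem IsForwardSolution.continuousOn_apply
    {F : EuclideanSpace ℝ (Fin n) → EuclideanSpace ℝ (Fin n)}
    {x : ℝ → EuclideanSpace ℝ (Fin n)} (hx : IsForwardSolution F x) (i : Fin n) :
    ContinuousOn (fun t => x t i) (Ici 0) :=
  (EuclideanSpace.proj (𝕜 := ℝ) i).continuous.comp_continuousOn hx.continuousOn

theorem IsForwardSolution.shift {E : Type*} [NormedAddCommGroup E] [NormedSpace ℝ E]
    {F : E → E} {x : ℝ → E} (hx : IsForwardSolution F x) {T : ℝ} (hT : 0 ≤ T) :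
    IsForwardSolution F fun t => x (t + T) := by
  intro t ht
  have h1 : HasDerivWithinAt (fun t => t + T) 1 (Ici 0) t :=
    ((hasDerivAt_id t).add_const T).hasDerivWithinAt
  have := (hx (t + T) (add_nonneg ht hT)).scomp t h1
    fun s hs => add_nonneg (show (0 : ℝ) ≤ s from hs) hT
  rwa [one_smul] at this

/-- The vector field is cooperative on the orthant, in the sense of Kamke. -/
def IsCooperative (F : EuclideanSpace ℝ (Fin n) → EuclideanSpace ℝ (Fin n)) : Prop :=
  ∀ x ∈ orthant n, ∀ y ∈ orthant n, (∀ j, x j ≤ y j) → ∀ i, x i = y i → F x i ≤ F y i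

variable {F : EuclideanSpace ℝ (Fin n) → EuclideanSpace ℝ (Fin n)}

/-- The field `F ∘ clampBox b` is bounded and Lipschitz, so it has global solutions. These never
leave the box, where the clamp is the identity. -/
theorem exists_isForwardSolution_mem_box (hF : ContDiff ℝ 1 F) (h0 : F 0 = 0)
    (hmono : IsCooperative F) {b : EuclideanSpace ℝ (Fin n)} (hb : b ∈ orthant n)
    (hneg : ∀ i, F b i < 0) {x₀ : EuclideanSpace ℝ (Fin n)} (hx₀ : x₀ ∈ orthant n)
    (hxb : ∀ i, x₀ i ≤ b i) :
    ∃ x : ℝ → EuclideanSpace ℝ (Fin n), x 0 = x₀ ∧ IsForwardSolution F x ∧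
      ∀ t, 0 ≤ t → x t ∈ orthant n ∧ ∀ i, x t i ≤ b i := by
  have hcomp : IsCompact (Metric.closedBall (0 : EuclideanSpace ℝ (Fin n)) ‖b‖) :=
    isCompact_closedBall _ _
  have hmaps : ∀ x, clampBox b x ∈ Metric.closedBall (0 : EuclideanSpace ℝ (Fin n)) ‖b‖ :=
    fun x => mem_closedBall_zero_iff.mpr (norm_clampBox_le hb x)
  obtain ⟨K, hK⟩ :=
    (hF.locallyLipschitz.locallyLipschitzOn).exists_lipschitzOnWith_of_compact hcomp
  have hlip : LipschitzWith (K * 1) (F ∘ clampBox b) := by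
    rw [← lipschitzOnWith_univ]
    exact hK.comp (lipschitzWith_clampBox b).lipschitzOnWith fun x _ => hmaps x
  obtain ⟨C, hC⟩ := hcomp.exists_bound_of_continuousOn hF.continuous.continuousOn
  obtain ⟨x, hx0, hx⟩ := exists_isForwardSolution_of_lipschitzWith hlip (C := C.toNNReal)
    (fun x => (hC _ (hmaps x)).trans (Real.le_coe_toNNReal C)) x₀
  -- On the face `xᵢ = bᵢ`, cooperativity bounds the speed by `F b i < 0`.
  have hupper : ∀ T, 0 ≤ T → ∀ i, x T i ≤ b i := by
    intro T hT i
    have := forall_nonpos_of_deriv_neg_of_eq_zero (a := 0) (b := T)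
      (g := fun i t => x t i - b i) (g' := fun i t => (F ∘ clampBox b) (x t) i)
      (fun i => ((hx.continuousOn_apply i).mono Icc_subset_Ici_self).sub continuousOn_const)
      (fun i t ht => (hx.hasDerivWithinAt_apply i ht.1).sub_const _)
      (fun i => by simpa [hx0] using hxb i)
      (fun t _ _ i hi => by
        refine (hmono _ (clampBox_mem_orthant b (x t)) _ hb (clampBox_le hb _) i ?_).trans_lt
          (hneg i)
        rw [clampBox_apply, sub_eq_zero.mp hi, min_self, max_eq_right (hb i)])
      T ⟨hT, le_rfl⟩ i
    linarith
  -- On the lower faces cooperativity gives only speed `≥ F 0 i = 0`; the slack `ε (1 + t)` makes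
  -- the inequality strict, and `ε` is arbitrary.
  have hlower : ∀ T, 0 ≤ T → ∀ ε > 0, ∀ i, -(ε * (1 + T)) ≤ x T i := by
    intro T hT ε hε i
    have := forall_nonpos_of_deriv_neg_of_eq_zero (a := 0) (b := T)
      (g := fun i t => -(ε * (1 + t)) - x t i)
      (g' := fun i t => -(ε * 1) - (F ∘ clampBox b) (x t) i)
      (fun i => ContinuousOn.sub (by fun_prop)
        ((hx.continuousOn_apply i).mono Icc_subset_Ici_self))
      (fun i t ht => ((((hasDerivAt_id t).const_add 1).const_mul ε).neg.hasDerivWithinAt).sub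
        (hx.hasDerivWithinAt_apply i ht.1))
      (fun i => by
        have := hx₀ i
        simp only [hx0]
        linarith)
      (fun t ht _ i hi => by
        have hxi : x t i ≤ 0 := by
          have := mul_pos hε (show 0 < 1 + t by linarith [ht.1])
          linarith
        have hnn := hmono 0 (fun _ => le_rfl) _ (clampBox_mem_orthant b (x t))
          (clampBox_mem_orthant b (x t)) i (by
            rw [clampBox_apply, max_eq_left ((min_le_left _ _).trans hxi)]
            rfl)
        have h0i : F 0 i = 0 := by rw [h0]; rfl
        rw [h0i] at hnn
        simp only [Function.comp_apply]
        linarith)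
      T ⟨hT, le_rfl⟩ i
    linarith
  have hmem : ∀ t, 0 ≤ t → x t ∈ orthant n := by
    intro t ht i
    refine le_of_forall_pos_le_add fun δ hδ => ?_
    have ht1 : 0 < 1 + t := by linarith
    have := hlower t ht (δ / (1 + t)) (by positivity) i
    rw [div_mul_cancel₀ _ ht1.ne'] at this
    linarith
  refine ⟨x, hx0, fun t ht => ?_, fun t ht => ⟨hmem t ht, hupper t ht⟩⟩
  have := hx t ht
  rwa [Function.comp_apply, clampBox_eq_self (hmem t ht) (hupper t ht)] at this

/-- Uniqueness carries the bounds of the constructed solution over to every solution. -/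
theorem IsForwardSolution.mem_box (hF : ContDiff ℝ 1 F) (h0 : F 0 = 0)
    (hmono : IsCooperative F) {b : EuclideanSpace ℝ (Fin n)} (hb : b ∈ orthant n)
    (hneg : ∀ i, F b i < 0) {x : ℝ → EuclideanSpace ℝ (Fin n)} (hx : IsForwardSolution F x)
    (hx0 : x 0 ∈ orthant n) (hxb : ∀ i, x 0 i ≤ b i) {t : ℝ} (ht : 0 ≤ t) :
    x t ∈ orthant n ∧ ∀ i, x t i ≤ b i := by
  obtain ⟨y, hy0, hy, hybox⟩ := exists_isForwardSolution_mem_box hF h0 hmono hb hneg hx0 hxb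
  rw [hx.eqOn hF hy hy0.symm ht]
  exact hybox t ht

theorem smul_mem_orthant {d : EuclideanSpace ℝ (Fin n)} (hd : ∀ i, 0 < d i) {s : ℝ}
    (hs : 0 ≤ s) : s • d ∈ orthant n :=
  fun i => mul_nonneg hs (hd i).le

/-- Compactness makes the negativity uniform; `c` is the speed at which the box can shrink. -/
theorem exists_forall_apply_smul_lt {d : EuclideanSpace ℝ (Fin n)} (hF : Continuous F)
    (hneg : ∀ s : ℝ, 0 < s → ∀ i, F (s • d) i < 0) {ε s₀ : ℝ} (hε : 0 < ε) :
    ∃ c > 0, ∀ s ∈ Icc ε s₀, ∀ i, F (s • d) i < -c * d i := by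
  have h : ∀ᶠ c : ℝ in 𝓝[>] 0, ∀ i, ∀ s ∈ Icc ε s₀, F (s • d) i < -c * d i := by
    rw [eventually_all]
    intro i
    have hcont : Continuous fun s : ℝ => F (s • d) i :=
      (EuclideanSpace.proj (𝕜 := ℝ) i).continuous.comp (hF.comp (by fun_prop))
    obtain ⟨m, hm, hle⟩ : ∃ m < 0, ∀ s ∈ Icc ε s₀, F (s • d) i ≤ m := by
      rcases (Icc ε s₀).eq_empty_or_nonempty with he | hne
      · exact ⟨-1, by norm_num, by simp [he]⟩
      · obtain ⟨s, hs, hmax⟩ := isCompact_Icc.exists_isMaxOn hne hcont.continuousOn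
        exact ⟨_, hneg s (hε.trans_le hs.1) i, fun s' hs' => hmax hs'⟩
    have htend : Tendsto (fun c : ℝ => -c * d i) (𝓝[>] 0) (𝓝 0) := by
      have : Continuous fun c : ℝ => -c * d i := by fun_prop
      simpa using (this.tendsto 0).mono_left nhdsWithin_le_nhds
    filter_upwards [htend.eventually_const_lt hm] with c hc s hs
    exact (hle s hs).trans_lt hc
  obtain ⟨c, hc, hc0⟩ := (h.and self_mem_nhdsWithin).exists
  exact ⟨c, hc0, fun s hs i => hc i s hs⟩

/-- A cooperative system on the orthant whose vector field points inwards along a positive ray is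
globally asymptotically stable. -/
theorem isGloballyAsymptoticallyStable_of_isCooperative (hF : ContDiff ℝ 1 F) (h0 : F 0 = 0)
    (hmono : IsCooperative F) {d : EuclideanSpace ℝ (Fin n)} (hd : ∀ i, 0 < d i)
    (hneg : ∀ s : ℝ, 0 < s → ∀ i, F (s • d) i < 0) :
    IsGloballyAsymptoticallyStable F (orthant n) 0 := by
  have hbox : ∀ s > 0, ∀ x : ℝ → EuclideanSpace ℝ (Fin n), IsForwardSolution F x →
      x 0 ∈ orthant n → (∀ i, x 0 i ≤ s * d i) →
      ∀ t, 0 ≤ t → x t ∈ orthant n ∧ ∀ i, x t i ≤ s * d i := fun s hs x hx hx0 hxs t ht =>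
    hx.mem_box hF h0 hmono (smul_mem_orthant hd hs.le) (hneg s hs) hx0 hxs ht
  have hinv : ∀ x : ℝ → EuclideanSpace ℝ (Fin n), IsForwardSolution F x → x 0 ∈ orthant n →
      ∀ t, 0 ≤ t → x t ∈ orthant n := fun x hx hx0 t ht => by
    obtain ⟨s, hs, hxs⟩ := exists_pos_le_smul hd (x 0)
    exact (hbox s hs x hx hx0 hxs t ht).1
  have hreach : ∀ ε > 0, ∀ x : ℝ → EuclideanSpace ℝ (Fin n), IsForwardSolution F x →
      x 0 ∈ orthant n → ∃ T, 0 ≤ T ∧ ∀ i, x T i ≤ ε * d i := by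
    intro ε hε x hx hx0
    obtain ⟨s₁, -, hxs₁⟩ := exists_pos_le_smul hd (x 0)
    set s₀ := max s₁ ε
    obtain ⟨c, hc, hlt⟩ := exists_forall_apply_smul_lt hF.continuous hneg (s₀ := s₀) hε
    have hT : 0 ≤ (s₀ - ε) / c := div_nonneg (sub_nonneg.mpr (le_max_right _ _)) hc.le
    -- The corner `(s₀ - c t) d` stays above the solution and reaches `ε d` at this time.
    refine ⟨(s₀ - ε) / c, hT, fun i => ?_⟩
    have := forall_nonpos_of_deriv_neg_of_eq_zero (a := 0) (b := (s₀ - ε) / c)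
      (g := fun i t => x t i - (s₀ - c * t) * d i)
      (g' := fun i t => F (x t) i - (-(c * 1)) * d i)
      (fun i => ((hx.continuousOn_apply i).mono Icc_subset_Ici_self).sub (by fun_prop))
      (fun i t ht => (hx.hasDerivWithinAt_apply i ht.1).sub
        ((((hasDerivAt_id t).const_mul c).const_sub s₀).mul_const (d i)).hasDerivWithinAt)
      (fun i => by
        have := mul_le_mul_of_nonneg_right (le_max_left s₁ ε) (hd i).le
        have h2 := hxs₁ i
        simp only [mul_zero, sub_zero]
        linarith)
      (fun t ht hle i hi => by
        have hct : c * t < s₀ - ε := by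
          have := (lt_div_iff₀ hc).mp ht.2
          linarith
        have hs : s₀ - c * t ∈ Icc ε s₀ :=
          ⟨by linarith, by linarith [mul_nonneg hc.le ht.1]⟩
        have h1 := hmono (x t) (hinv x hx hx0 t ht.1) ((s₀ - c * t) • d)
          (smul_mem_orthant hd (hε.le.trans hs.1)) (fun j => sub_nonpos.mp (hle j)) i
          (sub_eq_zero.mp hi)
        have h2 := hlt _ hs i
        linarith)
      _ ⟨hT, le_rfl⟩ i
    rw [mul_div_cancel₀ _ hc.ne'] at this
    linarith
  refine ⟨fun _ => le_rfl, h0, fun x₀ hx₀ => ?_, hinv, fun ε hε => ?_, fun x hx hx0 => ?_⟩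
  · obtain ⟨s, hs, hxs⟩ := exists_pos_le_smul hd x₀
    obtain ⟨x, h1, h2, -⟩ := exists_isForwardSolution_mem_box hF h0 hmono
      (smul_mem_orthant hd hs.le) (hneg s hs) hx₀ hxs
    exact ⟨x, h1, h2⟩
  -- Chosen so that `‖s • d‖ < ε`; the `+ 1` makes this strict and covers `d = 0` in dimension zero.
  · set s := ε / (‖d‖ + 1) with hsdef
    have hd1 : 0 < ‖d‖ + 1 := by positivity
    have hs : 0 < s := by positivity
    obtain ⟨δ, hδ, hδd⟩ : ∃ δ > 0, ∀ i, δ ≤ s * d i := by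
      have h : ∀ᶠ δ : ℝ in 𝓝[>] 0, ∀ i, δ ≤ s * d i := eventually_all.mpr fun i =>
        nhdsWithin_le_nhds (Iic_mem_nhds (mul_pos hs (hd i)))
      obtain ⟨δ, h1, h2⟩ := (h.and self_mem_nhdsWithin).exists
      exact ⟨δ, h2, h1⟩
    refine ⟨δ, hδ, fun x hx hx0 hxδ t ht => ?_⟩
    rw [sub_zero] at hxδ ⊢
    obtain ⟨hm, hle⟩ := hbox s hs x hx hx0 (fun i => by
      have : |x 0 i| ≤ ‖x 0‖ := PiLp.norm_apply_le (x 0) i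
      linarith [le_abs_self (x 0 i), hδd i]) t ht
    have h1 : ‖x t‖ ≤ ‖s • d‖ := EuclideanSpace.norm_le_norm_of_abs_le fun i => by
      rw [abs_of_nonneg (hm i), abs_of_nonneg (smul_mem_orthant hd hs.le i)]
      exact hle i
    rw [norm_smul, Real.norm_of_nonneg hs.le] at h1
    have h2 : s * (‖d‖ + 1) = ε := div_mul_cancel₀ _ hd1.ne'
    linarith
  · have hlim : ∀ i, Tendsto (fun t => x t i) atTop (𝓝 0) := by
      intro i
      rw [Metric.tendsto_atTop]
      intro ε hε
      -- From time `T` on, the solution is trapped in a box whose `i`-th side is `ε / 2`.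
      obtain ⟨T, hT, hxT⟩ := hreach (ε / 2 / d i) (div_pos (half_pos hε) (hd i)) x hx hx0
      refine ⟨T, fun t ht => ?_⟩
      obtain ⟨hm, hle⟩ := hbox (ε / 2 / d i) (div_pos (half_pos hε) (hd i)) _ (hx.shift hT)
        (by simpa using hinv x hx hx0 T hT) (by simpa using hxT) (t - T) (sub_nonneg.mpr ht)
      have h1 := hm i
      have h2 := hle i
      rw [div_mul_cancel₀ _ (hd i).ne'] at h2
      simp only [sub_add_cancel] at h1 h2
      rw [Real.dist_eq, sub_zero, abs_of_nonneg h1]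
      linarith
    have := (PiLp.continuous_toLp 2 (fun _ : Fin n => ℝ)).tendsto 0 |>.comp
      (tendsto_pi_nhds.mpr hlim)
    exact this

end Cooperative
-- Application to the network
namespace InterconnectedSystem

variable {n : ℕ} (S : InterconnectedSystem n)

theorem contDiff_field : ContDiff ℝ 1 S.field := by
  classical
  rw [contDiff_euclidean]
  intro i
  have h : ∀ j, ContDiff ℝ 1 fun x : EuclideanSpace ℝ (Fin n) => x j := fun j =>
    contDiff_euclidean.mp contDiff_id j
  exact (S.contDiff i).comp ((h i).prodMk (contDiff_pi.mpr fun j => h j))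

theorem fderiv_field_apply (x v : EuclideanSpace ℝ (Fin n)) (i : Fin n) :
    fderiv ℝ S.field x v i = ∑ j, S.jacobian x i j * v j := by
  have hv : v = ∑ j, v j • EuclideanSpace.single j (1 : ℝ) := by
    ext k
    simp [Finset.sum_apply, Pi.single_apply]
  conv_lhs => rw [hv, map_sum]
  simp [jacobian, mul_comm]

theorem hasDerivAt_field_line (x v : EuclideanSpace ℝ (Fin n)) (i : Fin n) (t : ℝ) :
    HasDerivAt (fun t : ℝ => S.field (x + t • v) i)
      (∑ j, S.jacobian (x + t • v) i j * v j) t := by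
  rw [← fderiv_field_apply]
  have h1 : HasDerivAt (fun t : ℝ => x + t • v) v t := by
    simpa using ((hasDerivAt_id t).smul_const v).const_add x
  have h2 := (S.contDiff_field.differentiable one_ne_zero (x + t • v)).hasFDerivAt
  exact (EuclideanSpace.proj (𝕜 := ℝ) i).hasFDerivAt.comp_hasDerivAt t (h2.comp_hasDerivAt t h1)

/-- Without an edge, `fᵢ` does not see `xⱼ` and is constant along that coordinate. -/
theorem jacobian_eq_zero {i j : Fin n} (hij : i ≠ j) (h : ¬ S.graph.Adj j i)
    (x : EuclideanSpace ℝ (Fin n)) : S.jacobian x i j = 0 := by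
  have h1 := S.hasDerivAt_field_line x (EuclideanSpace.single j 1) i 0
  have h2 : (fun t : ℝ => S.field (x + t • EuclideanSpace.single j 1) i) =
      fun _ => S.field x i := by
    funext t
    have hk : ∀ k, k ≠ j → (x + t • EuclideanSpace.single j (1 : ℝ)) k = x k := fun k hk => by
      simp [hk]
    simp only [field]
    rw [hk i hij]
    congr 2
    funext k
    exact hk k fun hkj => h (hkj ▸ k.2)
  rw [h2] at h1
  have := h1.unique (hasDerivAt_const _ _)
  simpa [Pi.single_apply] using this

/-- Along the segment from `x` to `y` the derivative of `fᵢ` is `∑ⱼ Jᵢⱼ (yⱼ - xⱼ)`; the diagonal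
term, of uncontrolled sign, drops out as `xᵢ = yᵢ`. -/
theorem isCooperative_field (h : ∀ x ∈ orthant n, IsMetzler (S.jacobian x)) :
    IsCooperative S.field := by
  intro x hx y hy hxy i hi
  have hmono : MonotoneOn (fun t : ℝ => S.field (x + t • (y - x)) i) (Icc 0 1) := by
    refine monotoneOn_of_deriv_nonneg (convex_Icc 0 1)
      (fun t _ => (S.hasDerivAt_field_line x (y - x) i t).continuousAt.continuousWithinAt)
      (fun t _ => (S.hasDerivAt_field_line x (y - x) i t).differentiableAt.differentiableWithinAt)
      fun t ht => ?_
    rw [interior_Icc] at ht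
    rw [(S.hasDerivAt_field_line x (y - x) i t).deriv]
    refine Finset.sum_nonneg fun j _ => ?_
    rcases eq_or_ne i j with rfl | hij
    · simp [hi]
    · refine mul_nonneg (h _ (fun k => ?_) i j hij) (sub_nonneg.mpr (hxy j))
      exact add_nonneg (hx k) (mul_nonneg ht.1.le (sub_nonneg.mpr (hxy k)))
  simpa using hmono (left_mem_Icc.mpr zero_le_one) (right_mem_Icc.mpr zero_le_one) zero_le_one

theorem field_smul_neg (h_zero : S.field 0 = 0) {d : EuclideanSpace ℝ (Fin n)}
    (hd : ∀ i, 0 < d i) (h : ∀ x ∈ orthant n, ∀ i, ∑ j, S.jacobian x i j * d j < 0)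
    {s : ℝ} (hs : 0 < s) (i : Fin n) : S.field (s • d) i < 0 := by
  have hanti : StrictAntiOn (fun t : ℝ => S.field (0 + t • d) i) (Ici 0) := by
    refine strictAntiOn_of_deriv_neg (convex_Ici 0)
      (fun t _ => (S.hasDerivAt_field_line 0 d i t).continuousAt.continuousWithinAt)
      fun t ht => ?_
    rw [interior_Ici] at ht
    rw [(S.hasDerivAt_field_line 0 d i t).deriv]
    refine h _ ?_ i
    rw [zero_add]
    exact smul_mem_orthant hd (le_of_lt ht)
  simpa [h_zero] using hanti self_mem_Ici hs.le hs

theorem comparisonMatrix_diag (γ : Fin n → Fin n → ℝ) (i : Fin n) :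
    S.comparisonMatrix γ i i = -1 := by
  simp [comparisonMatrix, S.loopless i]

theorem comparisonMatrix_nonneg {γ : Fin n → Fin n → ℝ}
    (h_pos : ∀ i j, S.graph.Adj j i → 0 < γ i j) {i j : Fin n} (hij : i ≠ j) :
    0 ≤ S.comparisonMatrix γ i j := by
  simp only [comparisonMatrix, Matrix.of_apply, if_neg hij]
  split_ifs with h
  · exact (h_pos i j h).le
  · exact le_rfl

/-- Equality holds on the diagonal, both sides vanish off the graph, and on edges this is the gain
bound with the denominator cleared. -/
theorem jacobian_le {γ : Fin n → Fin n → ℝ} {x : EuclideanSpace ℝ (Fin n)}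
    (h_diag : ∀ i, S.jacobian x i i < 0)
    (h_bound : ∀ i j, S.graph.Adj j i → S.jacobian x i j / -S.jacobian x i i ≤ γ i j)
    (i j : Fin n) : S.jacobian x i j ≤ -S.jacobian x i i * S.comparisonMatrix γ i j := by
  rcases eq_or_ne i j with rfl | hij
  · rw [comparisonMatrix_diag]
    linarith
  · by_cases h : S.graph.Adj j i
    · have := (div_le_iff₀ (neg_pos.mpr (h_diag i))).mp (h_bound i j h)
      simp only [comparisonMatrix, Matrix.of_apply, if_pos h]
      linarith
    · simp [comparisonMatrix, h, hij, S.jacobian_eq_zero hij h]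

theorem exists_pos_comparisonMatrix_mulVec_neg {γ : Fin n → Fin n → ℝ}
    (h_pos : ∀ i j, S.graph.Adj j i → 0 < γ i j)
    (h_gain : ∀ i : Fin n, totalCycleGain (leadingPrincipal (S.comparisonMatrix γ) i) < 1) :
    ∃ d : Fin n → ℝ, (∀ i, 0 < d i) ∧ ∀ i, (S.comparisonMatrix γ).mulVec d i < 0 := by
  obtain ⟨d, hd, hMd⟩ := exists_pos_mulVec_pos (-S.comparisonMatrix γ)
    (fun i j hij => neg_nonpos.mpr (S.comparisonMatrix_nonneg h_pos hij)) fun i => by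
      have h := det_neg_eq_one_sub_totalCycleGain (leadingPrincipal (S.comparisonMatrix γ) i)
        fun k => S.comparisonMatrix_diag γ _
      have h' : leadingPrincipal (-S.comparisonMatrix γ) i =
        -leadingPrincipal (S.comparisonMatrix γ) i := rfl
      rw [h', h]
      linarith [h_gain i]
  refine ⟨d, hd, fun i => ?_⟩
  have := hMd i
  rwa [Matrix.neg_mulVec, Pi.neg_apply, neg_pos] at this

end InterconnectedSystem

theorem mainTheorem4 (n : ℕ) (S : InterconnectedSystem n)
    (h_zero : S.field 0 = 0)
    (h_metzler : ∀ x ∈ orthant n, IsMetzler (S.jacobian x))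
    (h_diag : ∀ x ∈ orthant n, ∀ i, S.jacobian x i i < 0)
    (γ : Fin n → Fin n → ℝ)
    (h_pos : ∀ i j, S.graph.Adj j i → 0 < γ i j)
    (h_bound : ∀ i j, S.graph.Adj j i → ∀ x ∈ orthant n,
      S.jacobian x i j / -S.jacobian x i i ≤ γ i j)
    (h_gain : ∀ i : Fin n, totalCycleGain (leadingPrincipal (S.comparisonMatrix γ) i) < 1) :
    IsGloballyAsymptoticallyStable S.field (orthant n) 0 := by
  obtain ⟨d, hd, hMd⟩ := S.exists_pos_comparisonMatrix_mulVec_neg h_pos h_gain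
  refine isGloballyAsymptoticallyStable_of_isCooperative S.contDiff_field h_zero
    (S.isCooperative_field h_metzler) (d := WithLp.toLp 2 d) hd fun s hs i => ?_
  refine S.field_smul_neg h_zero hd (fun x hx i => ?_) hs i
  calc ∑ j, S.jacobian x i j * d j
      ≤ ∑ j, -S.jacobian x i i * (S.comparisonMatrix γ i j * d j) :=
        Finset.sum_le_sum fun j _ => by
          rw [← mul_assoc]
          exact mul_le_mul_of_nonneg_right
            (S.jacobian_le (h_diag x hx) (fun i j h => h_bound i j h x hx) i j) (hd j).le
    _ = -S.jacobian x i i * (S.comparisonMatrix γ).mulVec d i := by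
        rw [← Finset.mul_sum]
        rfl
    _ < 0 := mul_neg_of_pos_of_neg (neg_pos.mpr (h_diag x hx i)) (hMd i)
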